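/- Let $\tau$ be an infinite cardinal, let $G$ be an abelian group (written additively), and let $S\subseteq G$ be $\tau$-wide: for every integer $n\ge 1$ and every subset $S'\subseteq S$ with $|S'|<\tau$, the set $nS=\{nx : x\in S\}$ is not contained in the subgroup $\langle S'\rangle$ of $G$ generated by $S'$. Let $\mathbb{T}=\mathbb{R}/\mathbb{Z}$ be the circle group, and let $\mathbb{T}^{2^\tau}$ be the direct product of $2^\tau$ copies of $\mathbb{T}$ with the Tychonoff product topology. Then: (i) there exists a group homomorphism $\pi:G\to\mathbb{T}^{2^\tau}$ such that $\pi(S)$ is dense in $\mathbb{T}^{2^\tau}$; (ii) if, in addition, $|G|\le 2^{2^\tau}$, then there exists an injective group homomorphism (a monomorphism) $\pi:G\to\mathbb{T}^{2^\tau}$ such that $\pi(S)$ is dense in $\mathbb{T}^{2^\tau}$. -/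

import Mathlib

open Cardinal

universe u

/-- A subset `S` of an abelian group `G` is `τ`-wide if, for every positive integer `n` and every
`S' ⊆ S` with `|S'| < τ`, the set `nS = {n x : x ∈ S}` is not contained in the subgroup of `G`
generated by `S'`.  Here `nS` is written as an image, since the pointwise notation `n • S` could be
read as an iterated sumset. -/
def IsWide {G : Type u} [AddCommGroup G] (τ : Cardinal.{u}) (S : Set G) : Prop :=
  ∀ n : ℕ, 0 < n → ∀ S' : Set G, S' ⊆ S → #S' < τ →
    (((fun x : G => n • x) '' S) \ (AddSubgroup.closure S' : Set G)).Nonempty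

/-!
Write `𝕋` for `UnitAddCircle` and `D` for `I → 𝕋`, where `#I = 2 ^ τ`.

Identify `I` with the power set of a set of size `τ`. Functions of the trace of `A ∈ I` on a finite
set then give a dense family of at most `τ` points of `D` (`exists_approx_family`, the
Hewitt–Marczewski–Pondiczery theorem). Index by `τ` all pairs of a point `z` of this family and a
bound `N`. As `S` is `τ`-wide, transfinite recursion yields `x a ∈ S` such that no `k • x a` with
`0 < k < N a` lies in the subgroup generated by the earlier `x b` (`IsWide.exists_family`; apply
wideness to `n = (N a)!`).

It remains to find a homomorphism `π` with `π (x a)` close to `z a` in all coordinates at once. Its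
values `y a` are chosen by transfinite recursion, keeping the integer relations among the `y b`
equal to those among the `x b`. The step is `exists_extend_ker_eq_approx`: let `m` be the order of
`x` modulo the subgroup already treated. The equation `m • w = t` has solutions in `𝕋` within `1 / m`
of any point, and adding an element `θ` of order exactly `m` and small norm gives a second
solution. Choosing between the two in each coordinate gives `2 ^ #I` candidates. A candidate is bad
if it satisfies a relation with coefficient `k` not divisible by `m`, and each such relation is
satisfied by at most one candidate because `k • θ ≠ 0`. There are fewer than `2 ^ #I` relations, so
a good candidate exists. If no nonzero multiple of `x` lies in that subgroup, the same argument works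
with `θ` of infinite order and no equation on `w`.

Divisibility of `D` extends the resulting homomorphism to all of `G`, which is the first part. If
`#G ≤ 2 ^ 2 ^ τ`, the recursion can be continued through all elements of `G` with the trivial bound
`N = 1`; the equality of relations then says that `π` is injective.
-/

/-! ### Transfinite choice and extension of homomorphisms -/

/-- Choice by well-founded recursion: `y a` satisfies a condition depending on the earlier values
whenever that condition is satisfiable. -/
theorem exists_forall_lt_choice {W D : Type*} [LT W] [WellFoundedLT W] [Nonempty D]
    (Q : ∀ a : W, ({b : W // b < a} → D) → D → Prop) :
    ∃ y : W → D, ∀ a, (∃ d, Q a (fun b => y b) d) → Q a (fun b => y b) (y a) := by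
  let F : ∀ a : W, (∀ b : W, b < a → D) → D := fun a ih =>
    Classical.epsilon (Q a fun b => ih b b.2)
  refine ⟨wellFounded_lt.fix F, fun a h => ?_⟩
  have := Classical.epsilon_spec h
  rwa [wellFounded_lt.fix_eq F a]

/-- `Y` factors through the image of `X`, and the factor extends to `G` since a divisible group is
injective. -/
theorem AddMonoidHom.exists_comp_eq_of_ker_le {A G D : Type*} [AddCommGroup A] [AddCommGroup G]
    [AddCommGroup D] [DivisibleBy D ℤ] (X : A →+ G) (Y : A →+ D) (h : X.ker ≤ Y.ker) :
    ∃ π : G →+ D, ∀ a, π (X a) = Y a := by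
  obtain ⟨π, hπ⟩ := (Module.Baer.of_divisible D).extension_property_addMonoidHom
    (QuotientAddGroup.kerLift X) (QuotientAddGroup.kerLift_injective X)
    (QuotientAddGroup.lift X.ker Y h)
  exact ⟨π, fun a => DFunLike.congr_fun hπ (a : A ⧸ X.ker)⟩

/-! ### Approximation in the circle -/

theorem UnitAddCircle.norm_coe_le (r : ℝ) : ‖(r : UnitAddCircle)‖ ≤ |r| := by
  rw [UnitAddCircle.norm_eq]
  simpa using round_le r 0

theorem UnitAddCircle.exists_nsmul_eq_norm_sub_le (m : ℕ) (hm : 0 < m) (t z : UnitAddCircle) :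
    ∃ w : UnitAddCircle, m • w = t ∧ ‖w - z‖ ≤ 1 / m := by
  induction t using QuotientAddGroup.induction_on with | H t => ?_
  induction z using QuotientAddGroup.induction_on with | H z => ?_
  have hm' : (0 : ℝ) < m := by exact_mod_cast hm
  -- Among the lifts of the solutions, take the one nearest to `z`.
  refine ⟨(((t + round (m * z - t)) / m : ℝ) : UnitAddCircle), ?_, ?_⟩
  · rw [← AddCircle.coe_nsmul, nsmul_eq_mul, mul_div_cancel₀ _ hm'.ne', AddCircle.coe_add]
    simp
  · rw [← AddCircle.coe_sub]
    refine (UnitAddCircle.norm_coe_le _).trans ?_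
    have h := abs_sub_round (m * z - t)
    have e : (t + round (m * z - t)) / m - z = -((m * z - t) - round (m * z - t)) / m := by
      field_simp
      ring
    rw [e, abs_div, abs_neg, abs_of_pos hm']
    gcongr
    linarith

/-- The order `m = 0` stands for an element of infinite order. -/
theorem UnitAddCircle.exists_addOrderOf_eq_norm_le (m N : ℕ) (hN : 0 < N) (h : m = 0 ∨ N ≤ m) :
    ∃ θ : UnitAddCircle, addOrderOf θ = m ∧ ‖θ‖ ≤ 2 / N := by
  have hN' : (0 : ℝ) < N := by exact_mod_cast hN
  rcases h with rfl | h
  · refine ⟨((√2 / N : ℝ) : UnitAddCircle), ?_, ?_⟩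
    · rw [addOrderOf_eq_zero_iff, AddCircle.not_isOfFinAddOrder_iff_forall_rat_ne_div]
      intro q hq
      rw [div_one, eq_div_iff hN'.ne'] at hq
      exact irrational_sqrt_two ⟨q * N, by push_cast; exact hq⟩
    · refine (UnitAddCircle.norm_coe_le _).trans ?_
      rw [abs_of_nonneg (by positivity)]
      gcongr
      exact Real.sqrt_le_iff.mpr (by norm_num)
  · have hm : 0 < m := hN.trans_le h
    refine ⟨((1 / m : ℝ) : UnitAddCircle), AddCircle.addOrderOf_period_div hm, ?_⟩
    refine (UnitAddCircle.norm_coe_le _).trans ?_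
    rw [abs_of_nonneg (by positivity)]
    gcongr
    norm_num

/-! ### Families with prescribed relations near given points -/

/-- If `X` and `Y` have the same kernel and `A` is small, then `Y` can be extended to `x` by a value
`y` close to `z` in all coordinates, so that the kernels of the two maps on `ℤ × A` still agree. -/
theorem exists_extend_ker_eq_approx {A G I : Type u} [AddCommGroup A] [AddCommGroup G]
    (hA : #(ℤ × A) < 2 ^ #I) (X : A →+ G) (Y : A →+ (I → UnitAddCircle))
    (hXY : ∀ a, X a = 0 ↔ Y a = 0) (x : G) (z : I → UnitAddCircle) (N : ℕ) (hN : 0 < N)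
    (hx : ∀ k : ℕ, 0 < k → k < N → k • x ∉ X.range) :
    ∃ y : I → UnitAddCircle, (∀ i, ‖y i - z i‖ ≤ 3 / N) ∧
      ∀ (k : ℤ) (a : A), k • x + X a = 0 ↔ k • y + Y a = 0 := by
  classical
  -- `m = 0` if no nonzero multiple of `x` lies in the range of `X`; divisibility by `m` treats
  -- this case together with that of finite order.
  set m := addOrderOf (x : G ⧸ X.range) with hm
  have hdvd : ∀ k : ℤ, (m : ℤ) ∣ k ↔ k • x ∈ X.range := fun k => by
    rw [hm, addOrderOf_dvd_iff_zsmul_eq_zero, ← QuotientAddGroup.mk_zsmul,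
      QuotientAddGroup.eq_zero_iff]
  have hmN : m = 0 ∨ N ≤ m := by
    by_contra! h
    refine hx m (Nat.pos_of_ne_zero h.1) h.2 ?_
    simpa using (hdvd m).1 dvd_rfl
  obtain ⟨a₀, ha₀⟩ := (hdvd m).1 dvd_rfl
  obtain ⟨θ, hθm, hθ⟩ := UnitAddCircle.exists_addOrderOf_eq_norm_le m N hN hmN
  have hN' : (0 : ℝ) < N := by exact_mod_cast hN
  have hw : ∀ i, ∃ w : UnitAddCircle, m • w = Y a₀ i ∧ ‖w - z i‖ ≤ 1 / N := by
    intro i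
    rcases hmN with h0 | h
    · have : Y a₀ = 0 := (hXY a₀).1 (by rw [ha₀, h0]; simp)
      exact ⟨z i, by simp [h0, this], by simp⟩
    · obtain ⟨w, h1, h2⟩ :=
        UnitAddCircle.exists_nsmul_eq_norm_sub_le m (hN.trans_le h) (Y a₀ i) (z i)
      exact ⟨w, h1, h2.trans (by gcongr)⟩
  choose w hwm hwz using hw
  -- The candidates: the coordinates in `s` use the second solution `w i + θ`.
  let y : Set I → I → UnitAddCircle := fun s i => w i + if i ∈ s then θ else 0
  have hθ0 : ∀ k : ℤ, k • θ = 0 ↔ (m : ℤ) ∣ k := fun k => by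
    rw [← hθm, addOrderOf_dvd_iff_zsmul_eq_zero]
  have hmy : ∀ s, (m : ℤ) • y s = Y a₀ := by
    intro s
    funext i
    have : (m : ℤ) • θ = 0 := (hθ0 m).2 dvd_rfl
    simp only [natCast_zsmul] at this
    by_cases hi : i ∈ s <;> simp [y, hi, hwm, this]
  obtain ⟨s, hs⟩ : ∃ s : Set I, ∀ (k : ℤ) (a : A), k • y s + Y a = 0 → (m : ℤ) ∣ k := by
    -- Otherwise sending `s` to a bad relation satisfied by `y s` injects `Set I` into `ℤ × A`.
    by_contra! hbad
    choose k a hka hk using hbad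
    refine hA.not_ge ?_
    rw [← mk_set]
    refine mk_le_of_injective (f := fun s => (k s, a s)) fun s t hst => ?_
    obtain ⟨hkst, hast⟩ := Prod.mk.inj hst
    have he : k s • y s = k s • y t := by
      have h1 := hka s
      have h2 := hka t
      rw [← hkst, ← hast] at h2
      exact add_right_cancel (h1.trans h2.symm)
    have hkθ : k s • θ ≠ 0 := fun h => hk s ((hθ0 _).1 h)
    ext i
    have hi := congrFun he i
    by_cases h1 : i ∈ s <;> by_cases h2 : i ∈ t <;> simp [y, h1, h2, smul_add] at hi ⊢
    · exact hkθ hi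
    · exact hkθ hi
  refine ⟨y s, fun i => ?_, fun k a => ?_⟩
  · have : y s i - z i = (w i - z i) + if i ∈ s then θ else 0 := by simp only [y]; abel
    rw [this]
    refine (norm_add_le _ _).trans ?_
    have h2 : ‖if i ∈ s then θ else 0‖ ≤ 2 / (N : ℝ) := by
      split_ifs
      · exact hθ
      · rw [norm_zero]
        positivity
    calc _ ≤ 1 / (N : ℝ) + 2 / N := add_le_add (hwz i) h2
      _ = 3 / N := by ring
  · have key : (m : ℤ) ∣ k → (k • x + X a = 0 ↔ k • y s + Y a = 0) := by
      rintro ⟨q, rfl⟩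
      rw [mul_comm, mul_smul, mul_smul, hmy, ← ha₀, ← map_zsmul, ← map_zsmul, ← map_add, ← map_add]
      exact hXY _
    refine ⟨fun h => (key ?_).1 h, fun h => (key (hs k a h)).2 h⟩
    rw [hdvd]
    exact ⟨-a, by rw [map_neg, eq_comm]; exact eq_neg_of_add_eq_zero_left h⟩

theorem mk_int_prod_finsupp_lt {α : Type u} {c : Cardinal.{u}} (hα : #α < c) (hc : ℵ₀ < c) :
    #(ℤ × (α →₀ ℤ)) < c := by
  have h1 : #(α →₀ ℤ) < c := by
    rcases isEmpty_or_nonempty α with h | h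
    · exact (lt_aleph0_of_finite _).trans hc
    · simpa using ⟨hα, hc⟩
  rw [mk_prod]
  exact mul_lt_of_lt hc.le (by simpa using hc) (by simpa using h1)

/-- Equality of relations is checked one index at a time, by looking at the largest index that occurs
in a relation. -/
theorem Finsupp.linearCombination_eq_zero_iff_of_step {W G D : Type*} [LinearOrder W]
    [AddCommGroup G] [AddCommGroup D] (x : W → G) (y : W → D) (U : Set W)
    (h : ∀ a ∈ U, ∀ (k : ℤ) (f : {b : W // b < a} →₀ ℤ),
      k • x a + Finsupp.linearCombination ℤ (fun b : {b : W // b < a} => x b) f = 0 ↔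
      k • y a + Finsupp.linearCombination ℤ (fun b : {b : W // b < a} => y b) f = 0)
    (f : W →₀ ℤ) (hf : ∀ a ∈ f.support, a ∈ U) :
    Finsupp.linearCombination ℤ x f = 0 ↔ Finsupp.linearCombination ℤ y f = 0 := by
  induction f using Finsupp.induction_on_max with
  | zero => simp
  | single_add a k f hlt hk _ =>
    have ha : a ∈ U := by
      refine hf a ?_
      have : f a = 0 := Finsupp.notMem_support_iff.1 fun h => (hlt a h).false
      simp [this, hk]
    have key := h a ha k (f.comapDomain (fun b : {b : W // b < a} => (b : W))
      Subtype.val_injective.injOn)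
    have e : f = (f.comapDomain (fun b : {b : W // b < a} => (b : W))
        Subtype.val_injective.injOn).mapDomain Subtype.val := by
      refine (Finsupp.mapDomain_comapDomain _ Subtype.val_injective f fun b hb => ?_).symm
      exact ⟨⟨b, hlt b hb⟩, rfl⟩
    rw [map_add, map_add, Finsupp.linearCombination_single, Finsupp.linearCombination_single]
    rw [e, Finsupp.linearCombination_mapDomain, Finsupp.linearCombination_mapDomain]
    exact key

/-- Transfinite iteration of `exists_extend_ker_eq_approx`: a family `y` near `z` with the same
integer relations as `x`. -/
theorem exists_ker_eq_approx {W G I : Type u} [LinearOrder W] [WellFoundedLT W] [AddCommGroup G]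
    (hI : ℵ₀ < 2 ^ #I) (hW : ∀ a : W, #{b : W // b < a} < 2 ^ #I)
    (x : W → G) (z : W → I → UnitAddCircle) (N : W → ℕ) (hN : ∀ a, 0 < N a)
    (hx : ∀ a, ∀ k : ℕ, 0 < k → k < N a →
      k • x a ∉ AddSubgroup.closure (Set.range fun b : {b : W // b < a} => x b)) :
    ∃ y : W → I → UnitAddCircle, (∀ a i, ‖y a i - z a i‖ ≤ 3 / N a) ∧
      ∀ f : W →₀ ℤ,
        Finsupp.linearCombination ℤ x f = 0 ↔ Finsupp.linearCombination ℤ y f = 0 := by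
  let Q : ∀ a : W, ({b : W // b < a} → I → UnitAddCircle) → (I → UnitAddCircle) → Prop :=
    fun a v d => (∀ i, ‖d i - z a i‖ ≤ 3 / N a) ∧
      ∀ (k : ℤ) (f : {b : W // b < a} →₀ ℤ),
        k • x a + Finsupp.linearCombination ℤ (fun b : {b : W // b < a} => x b) f = 0 ↔
        k • d + Finsupp.linearCombination ℤ v f = 0
  obtain ⟨y, hy⟩ := exists_forall_lt_choice Q
  have good : ∀ a, Q a (fun b => y b) (y a) := by
    intro a
    induction a using WellFoundedLT.induction with
    | ind a ih => ?_
    apply hy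
    refine exists_extend_ker_eq_approx (mk_int_prod_finsupp_lt (hW a) hI)
      (Finsupp.linearCombination ℤ fun b : {b : W // b < a} => x b).toAddMonoidHom
      (Finsupp.linearCombination ℤ fun b : {b : W // b < a} => y b).toAddMonoidHom
      (fun f => ?_) (x a) (z a) (N a) (hN a) fun k hk hkN hmem => hx a k hk hkN ?_
    · have := Finsupp.linearCombination_eq_zero_iff_of_step x y (Set.Iio a)
        (fun b hb => (ih b hb).2) (f.mapDomain Subtype.val) fun b hb => by
          classical
          obtain ⟨c, -, rfl⟩ := Finset.mem_image.1 (Finsupp.mapDomain_support hb)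
          exact c.2
      rwa [Finsupp.linearCombination_mapDomain, Finsupp.linearCombination_mapDomain] at this
    · obtain ⟨f, hf⟩ := hmem
      rw [← hf]
      change Finsupp.linearCombination ℤ (fun b : {b : W // b < a} => x b) f ∈ _
      rw [Finsupp.linearCombination_apply]
      exact AddSubgroup.sum_mem _ fun b _ =>
        AddSubgroup.zsmul_mem _ (AddSubgroup.subset_closure (Set.mem_range_self b)) _
  exact ⟨y, fun a => (good a).1, fun f =>
    Finsupp.linearCombination_eq_zero_iff_of_step x y Set.univ (fun a _ => (good a).2) f (by simp)⟩

/-! ### A small dense family in the power of the circle -/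

/-- The Hewitt–Marczewski–Pondiczery theorem for the circle, with density spelled out on finitely
many coordinates. -/
theorem exists_approx_family {τ : Cardinal.{u}} (hτ : ℵ₀ ≤ τ) {I : Type u} (hI : #I = 2 ^ τ) :
    ∃ (E : Type u) (z : E → I → UnitAddCircle), Nonempty E ∧ #E ≤ τ ∧
      ∀ (p : I → UnitAddCircle) (J : Finset I) (ε : ℝ), 0 < ε →
        ∃ e, ∀ i ∈ J, ‖z e i - p i‖ < ε := by
  classical
  induction τ using Cardinal.inductionOn with | mk T => ?_
  have : Infinite T := infinite_iff.2 hτ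
  rw [← mk_set] at hI
  obtain ⟨φ⟩ := Cardinal.eq.1 hI
  let tr : Finset T → I → Finset T := fun F i => F.filter (· ∈ φ i)
  refine ⟨Finset T × (Finset T →₀ ℚ), fun e i => ((e.2 (tr e.1 i) : ℝ) : UnitAddCircle),
    inferInstance, ?_, fun p J ε hε => ?_⟩
  · rw [mk_prod]
    refine mul_le_of_le hτ ?_ ?_ <;> simp [hτ]
  · -- A finite set `F` separates the sets `φ i` with `i ∈ J`: their traces on it are distinct.
    have hsep : ∀ i j : I, ∃ t : T, i ≠ j → ¬ (t ∈ φ i ↔ t ∈ φ j) := by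
      intro i j
      by_contra! h
      obtain ⟨t⟩ := (inferInstance : Nonempty T)
      exact (h t).1 (φ.injective (Set.ext fun s => (h s).2))
    choose g hg using hsep
    let F : Finset T := (J ×ˢ J).image fun q => g q.1 q.2
    have hinj : Set.InjOn (tr F) J := by
      intro i hi j hj hij
      by_contra hne
      refine hg i j hne ?_
      have hF : g i j ∈ F := Finset.mem_image.2 ⟨(i, j), Finset.mem_product.2 ⟨hi, hj⟩, rfl⟩
      have := Finset.ext_iff.1 hij (g i j)
      simpa [tr, hF] using this
    have hq : ∀ i, ∃ q : ℚ, ‖((q : ℝ) : UnitAddCircle) - p i‖ < ε := by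
      intro i
      induction p i using QuotientAddGroup.induction_on with | H r => ?_
      obtain ⟨q, hq⟩ := (Rat.denseRange_cast (𝕜 := ℝ)).exists_dist_lt r hε
      refine ⟨q, ?_⟩
      rw [← AddCircle.coe_sub]
      refine (UnitAddCircle.norm_coe_le _).trans_lt ?_
      rwa [dist_comm, Real.dist_eq] at hq
    choose q hq using hq
    have : Nonempty I := ⟨φ.symm ∅⟩
    refine ⟨(F, Finsupp.indicator (J.image (tr F)) fun t _ => q (Function.invFunOn (tr F) J t)),
      fun i hi => ?_⟩
    dsimp only
    rw [Finsupp.indicator_of_mem (Finset.mem_image_of_mem _ hi), hinj.leftInvOn_invFunOn hi]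
    exact hq i

/-! ### Families in wide sets -/

/-- A wide set contains a well-ordered family whose members have prescribed lower bounds `N a` for
their orders modulo the subgroup generated by their predecessors. -/
theorem IsWide.exists_family {G W : Type u} [AddCommGroup G] [LinearOrder W] [WellFoundedLT W]
    {τ : Cardinal.{u}} {S : Set G} (hS : IsWide τ S) (hW : ∀ a : W, #{b : W // b < a} < τ)
    (N : W → ℕ) :
    ∃ x : W → G, (∀ a, x a ∈ S) ∧ ∀ a, ∀ k : ℕ, 0 < k → k < N a →
      k • x a ∉ AddSubgroup.closure (Set.range fun b : {b : W // b < a} => x b) := by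
  obtain ⟨x, hx⟩ := exists_forall_lt_choice (W := W) fun a (v : {b : W // b < a} → G) d =>
    d ∈ S ∧ ∀ k : ℕ, 0 < k → k < N a → k • d ∉ AddSubgroup.closure (Set.range v)
  have good : ∀ a, x a ∈ S ∧ ∀ k : ℕ, 0 < k → k < N a →
      k • x a ∉ AddSubgroup.closure (Set.range fun b : {b : W // b < a} => x b) := by
    intro a
    induction a using WellFoundedLT.induction with
    | ind a ih => ?_
    apply hx
    -- If `(N a)! • d` avoids the subgroup, so does `k • d` for each divisor `k` of `(N a)!`.
    obtain ⟨-, ⟨d, hd, rfl⟩, hdn⟩ := hS (N a).factorial (Nat.factorial_pos _)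
      (Set.range fun b : {b : W // b < a} => x b)
      (Set.range_subset_iff.2 fun b => (ih b b.2).1) (mk_range_le.trans_lt (hW a))
    refine ⟨d, hd, fun k hk hkN hmem => hdn ?_⟩
    obtain ⟨c, hc⟩ := Nat.dvd_factorial hk hkN.le
    change (N a).factorial • d ∈ _
    rw [hc, mul_comm, mul_smul]
    exact AddSubgroup.nsmul_mem _ hmem c
  exact ⟨x, fun a => (good a).1, fun a => (good a).2⟩

/-! ### Homomorphisms with dense image -/

theorem exists_addMonoidHom_approx {W G I : Type u} [LinearOrder W] [WellFoundedLT W]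
    [AddCommGroup G] (hI : ℵ₀ < 2 ^ #I) (hW : ∀ a : W, #{b : W // b < a} < 2 ^ #I)
    (x : W → G) (z : W → I → UnitAddCircle) (N : W → ℕ) (hN : ∀ a, 0 < N a)
    (hx : ∀ a, ∀ k : ℕ, 0 < k → k < N a →
      k • x a ∉ AddSubgroup.closure (Set.range fun b : {b : W // b < a} => x b)) :
    ∃ π : G →+ (I → UnitAddCircle), (∀ a i, ‖π (x a) i - z a i‖ ≤ 3 / N a) ∧
      (Function.Surjective x → Function.Injective π) := by
  obtain ⟨y, hyz, hxy⟩ := exists_ker_eq_approx hI hW x z N hN hx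
  obtain ⟨π, hπ⟩ := AddMonoidHom.exists_comp_eq_of_ker_le
    (Finsupp.linearCombination ℤ x).toAddMonoidHom (Finsupp.linearCombination ℤ y).toAddMonoidHom
    fun f hf => (hxy f).1 hf
  have hπx : ∀ a, π (x a) = y a := fun a => by simpa using hπ (Finsupp.single a 1)
  refine ⟨π, fun a i => by rw [hπx]; exact hyz a i, fun hsurj => ?_⟩
  rw [injective_iff_map_eq_zero]
  intro g hg
  obtain ⟨a, rfl⟩ := hsurj g
  rw [hπx] at hg
  simpa using (hxy (Finsupp.single a 1)).2 (by simpa using hg)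

/-- The family `x` is continued by an enumeration of `G` in order type `(#G).ord`, with `N = 1` and
arbitrary targets there, which makes it surjective. -/
theorem exists_injective_addMonoidHom_approx {W G I : Type u} [LinearOrder W] [WellFoundedLT W]
    [AddCommGroup G] (hI : ℵ₀ < 2 ^ #I) (hW : #W < 2 ^ #I) (hG : #G ≤ 2 ^ #I)
    (x : W → G) (z : W → I → UnitAddCircle) (N : W → ℕ) (hN : ∀ a, 0 < N a)
    (hx : ∀ a, ∀ k : ℕ, 0 < k → k < N a →
      k • x a ∉ AddSubgroup.closure (Set.range fun b : {b : W // b < a} => x b)) :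
    ∃ π : G →+ (I → UnitAddCircle), Function.Injective π ∧
      ∀ a i, ‖π (x a) i - z a i‖ ≤ 3 / N a := by
  obtain ⟨e⟩ := Cardinal.eq.1 (mk_ord_toType #G)
  let V := (#G).ord.ToType
  have : WellFoundedLT (W ⊕ₗ V) := ⟨Sum.lex_wf wellFounded_lt wellFounded_lt⟩
  have hV : ∀ a : V, #(Set.Iio a) < #G := fun a => by
    simpa [V] using mk_Iio_lt a (by simp [V])
  have hWV : ∀ a : W ⊕ₗ V, #{b : W ⊕ₗ V // b < a} < 2 ^ #I := by
    intro a
    rcases h : ofLex a with w | v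
    · obtain rfl : a = toLex (Sum.inl w) := h
      refine ((mk_le_mk_of_subset (t := Set.range fun w : W => toLex (Sum.inl w)) ?_).trans
        mk_range_le).trans_lt hW
      intro b hb
      rcases h : ofLex b with w' | v
      · exact ⟨w', h.symm⟩
      · obtain rfl : b = toLex (Sum.inr v) := h
        exact absurd hb Sum.Lex.not_inr_lt_inl
    · obtain rfl : a = toLex (Sum.inr v) := h
      refine ((mk_le_mk_of_subset (t := (Set.range fun w : W => toLex (Sum.inl w)) ∪
        (fun v' : V => toLex (Sum.inr v')) '' Set.Iio v) ?_).trans (mk_union_le _ _)).trans_lt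
        (add_lt_of_lt hI.le (mk_range_le.trans_lt hW)
          (mk_image_le.trans_lt ((hV v).trans_le hG)))
      intro b hb
      rcases h : ofLex b with w' | v'
      · exact Or.inl ⟨w', h.symm⟩
      · obtain rfl : b = toLex (Sum.inr v') := h
        exact Or.inr ⟨v', Sum.Lex.inr_lt_inr_iff.1 hb, rfl⟩
  obtain ⟨π, hπ, hinj⟩ := exists_addMonoidHom_approx hI hWV (fun a => Sum.elim x e (ofLex a))
    (fun a => Sum.elim z 0 (ofLex a)) (fun a => Sum.elim N 1 (ofLex a))
    (fun a => by rcases h : ofLex a with w | v <;> simp [hN]) (fun a k hk hkN => by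
      rcases h : ofLex a with w | v
      · obtain rfl : a = toLex (Sum.inl w) := h
        refine fun hmem => hx w k hk hkN (AddSubgroup.closure_mono ?_ hmem)
        rintro - ⟨⟨b, hb⟩, rfl⟩
        rcases h : ofLex b with w' | v
        · obtain rfl : b = toLex (Sum.inl w') := h
          exact ⟨⟨w', Sum.Lex.inl_lt_inl_iff.1 hb⟩, rfl⟩
        · obtain rfl : b = toLex (Sum.inr v) := h
          exact absurd hb Sum.Lex.not_inr_lt_inl
      · rw [h] at hkN
        exact absurd hk (Nat.lt_one_iff.1 hkN).not_gt)
  exact ⟨π, hinj fun g => ⟨toLex (Sum.inr (e.symm g)), by simp⟩,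
    fun a => hπ (toLex (Sum.inl a))⟩

theorem dense_of_forall_exists_norm_sub_lt {I : Type*} {s : Set (I → UnitAddCircle)}
    (h : ∀ (p : I → UnitAddCircle) (J : Finset I) (ε : ℝ), 0 < ε →
      ∃ d ∈ s, ∀ i ∈ J, ‖d i - p i‖ < ε) : Dense s := by
  intro p
  have hb := Filter.hasBasis_pi fun i => Metric.nhds_basis_ball (x := p i)
  rw [← nhds_pi] at hb
  rw [mem_closure_iff_nhds_basis hb]
  rintro ⟨J, δ⟩ ⟨hJ, hδ⟩
  obtain ⟨ε, hε, hεδ⟩ : ∃ ε > 0, ∀ i ∈ J, ε ≤ δ i := by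
    have h1 : ∀ᶠ ε in nhdsWithin (0 : ℝ) (Set.Ioi 0), ∀ i ∈ J, ε ≤ δ i := by
      rw [Filter.eventually_all_finite hJ]
      intro i hi
      filter_upwards [Ioo_mem_nhdsGT (hδ i hi)] with ε hε using hε.2.le
    obtain ⟨ε, h2, h3⟩ := (h1.and self_mem_nhdsWithin).exists
    exact ⟨ε, h3, h2⟩
  obtain ⟨d, hd, h⟩ := h p hJ.toFinset ε hε
  refine ⟨d, hd, fun i hi => ?_⟩
  rw [Metric.mem_ball, dist_eq_norm]
  exact (h i (hJ.mem_toFinset.2 hi)).trans_le (hεδ i hi)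

/-- `UnitAddCircle` is `ℝ / ℤ`, and `I → UnitAddCircle` carries the product topology.  The power
`𝕋 ^ (2 ^ τ)` is the product of copies of `𝕋` over an arbitrary index set `I` of
cardinality `2 ^ τ`. -/
theorem mainTheorem6 {G : Type u} [AddCommGroup G] (τ : Cardinal.{u}) (hτ : ℵ₀ ≤ τ)
    (S : Set G) (hS : IsWide τ S) (I : Type u) (hI : #I = 2 ^ τ) :
    (∃ π : G →+ (I → UnitAddCircle), Dense (π '' S)) ∧
    (#G ≤ 2 ^ ((2 : Cardinal.{u}) ^ τ) →
      ∃ π : G →+ (I → UnitAddCircle), Function.Injective π ∧ Dense (π '' S)) := by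
  obtain ⟨E, zE, hE, hEτ, hdense⟩ := exists_approx_family hτ hI
  have hτI : τ < 2 ^ #I := (cantor τ).trans (hI ▸ cantor #I)
  have hcI : ℵ₀ < 2 ^ #I := hτ.trans_lt hτI
  have hsmall : ∀ a : τ.ord.ToType, #{b // b < a} < τ := fun a =>
    (mk_Iio_lt a (by simp)).trans_eq (mk_ord_toType τ)
  obtain ⟨ℓ, hℓ⟩ : ∃ ℓ : τ.ord.ToType → E × ℕ, Function.Surjective ℓ := by
    have hle : #(E × ℕ) ≤ #τ.ord.ToType := by
      rw [mk_prod]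
      refine (mul_le_of_le hτ ?_ ?_).trans (mk_ord_toType τ).ge <;> simp [hτ, hEτ]
    obtain ⟨f⟩ := hle
    exact ⟨Function.invFun f, Function.invFun_surjective f.injective⟩
  obtain ⟨x, hxS, hx⟩ := hS.exists_family hsmall fun a => (ℓ a).2 + 1
  have hπ : ∀ π : G →+ (I → UnitAddCircle),
      (∀ a i, ‖π (x a) i - zE (ℓ a).1 i‖ ≤ 3 / ((ℓ a).2 + 1 : ℕ)) → Dense (π '' S) := by
    intro π h
    refine dense_of_forall_exists_norm_sub_lt fun p J ε hε => ?_
    obtain ⟨e, he⟩ := hdense p J (ε / 2) (half_pos hε)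
    obtain ⟨n, hn⟩ := exists_nat_one_div_lt (show 0 < ε / 6 by positivity)
    obtain ⟨a, ha⟩ := hℓ (e, n)
    refine ⟨π (x a), ⟨x a, hxS a, rfl⟩, fun i hi => ?_⟩
    have h1 := h a i
    rw [ha] at h1
    have h2 : 3 / ((n + 1 : ℕ) : ℝ) < ε / 2 := by
      push_cast
      rw [show (3 : ℝ) / (n + 1) = 3 * (1 / (n + 1)) by ring]
      linarith
    calc ‖π (x a) i - p i‖ ≤ ‖π (x a) i - zE e i‖ + ‖zE e i - p i‖ :=
          norm_sub_le_norm_sub_add_norm_sub _ _ _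
      _ < ε := by linarith [he i hi]
  constructor
  · obtain ⟨π, h, -⟩ := exists_addMonoidHom_approx hcI (fun a => (hsmall a).trans hτI) x
      (fun a => zE (ℓ a).1) (fun a => (ℓ a).2 + 1) (fun a => Nat.succ_pos _) hx
    exact ⟨π, hπ π h⟩
  · intro hG
    obtain ⟨π, hinj, h⟩ := exists_injective_addMonoidHom_approx hcI
      ((mk_ord_toType τ).trans_lt hτI) (hI ▸ hG) x
      (fun a => zE (ℓ a).1) (fun a => (ℓ a).2 + 1) (fun a => Nat.succ_pos _) hx
    exact ⟨π, hinj, hπ π h⟩
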